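/- There is a universal constant $C>0$ such that the following holds. Let $\mathcal{X}\subseteq\mathbb{R}^n$ be closed and convex, and let $f:\mathcal{X}\to\mathbb{R}$ be convex and attain its minimum $f_\star$ at a point $x_\star\in\mathcal{X}$. Let $\mathcal{G}$ be a stochastic gradient oracle: a query at $x\in\mathcal{X}$ returns a random vector $\mathcal{G}(x)\in\mathbb{R}^n$, whose law depends measurably on $x$ and which satisfies $\mathbb{E}[\mathcal{G}(x)]\in\partial f(x)$. Suppose that there is a continuous $\ell:\mathcal{X}\to\mathbb{R}$ with $\|\mathcal{G}(x)\|\le\ell(x)$ almost surely for every $x\in\mathcal{X}$, where $\|\cdot\|$ is the Euclidean norm. Let $x_0\in\mathcal{X}$ and $r_\epsilon>0$, and for $t\ge 0$ let $$x_{t+1}=\mathrm{Proj}_{\mathcal{X}}(x_t-\eta_t g_t),\qquad \eta_t=\frac{\bar r_t}{\sqrt{G'_t}},$$ where $g_t$ is the answer of the oracle to a query at $x_t$ (that is, conditionally on $g_0,\dots,g_{t-1}$ it has the law of $\mathcal{G}(x)$ at $x=x_t$), and where $$\bar r_t=\max\Big\{\max_{k\le t}\|x_k-x_0\|,\;r_\epsilon\Big\},\qquad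 G_t=\sum_{k=0}^{t}\|g_k\|^2 .$$ Here $(G'_t)_{t\ge0}$ is almost surely a positive nondecreasing sequence with $G'_t\ge G_t$ for all $t$, and each $G'_t$ is a measurable function of $x_0,g_0,\dots,g_t$ only. Put $$\bar x_t=\frac{\sum_{k=0}^{t-1}\bar r_k x_k}{\sum_{k=0}^{t-1}\bar r_k},\qquad d_0=\|x_0-x_\star\|,\qquad \bar L_t=\max_{k\le t}\ell(x_k),\qquad \theta_{t,\delta}=\log\frac{60\log(6t)}{\delta}.$$ Then for all $\delta\in(0,1)$, $L>0$ and $T\in\mathbb{N}$, with probability at least $1-\delta-\mathbb{P}(\bar L_T>L)$, the following bound holds simultaneously for all integers $1\le t\le T$: $$f(\bar x_t)-f_\star\;\le\; C\,\frac{(d_0+\bar r_t)\sqrt{G'_{t-1}+G_{t-1}\theta_{t,\delta}+L^2\theta_{t,\delta}^2}}{\sum_{i<t}\bar r_i/\bar r_t}.$$ -/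

import Mathlib

open MeasureTheory ProbabilityTheory

namespace DoG

/-- Euclidean space `ℝⁿ`. -/
abbrev Euc (n : ℕ) : Type := EuclideanSpace ℝ (Fin n)

/-- The subdifferential at `x` of a function `f` with domain `X` (only the values of `f` on `X`
matter). -/
def subdifferential {n : ℕ} (X : Set (Euc n)) (f : Euc n → ℝ) (x : Euc n) : Set (Euc n) :=
  {v | ∀ y ∈ X, f x + inner ℝ v (y - x) ≤ f y}

/-- `f` is convex on the closed convex domain `X` and attains its minimum over `X` at `xstar`. -/
structure ConvexProblem {n : ℕ} (X : Set (Euc n)) (f : Euc n → ℝ) (xstar : Euc n) : Prop where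
  isClosed : IsClosed X
  convexOn : ConvexOn ℝ X f
  mem : xstar ∈ X
  isMinOn : IsMinOn f X xstar

/-- A stochastic gradient oracle is given by the law `κ x` of the answer to a query at `x`.
At each point `x` of the domain its mean exists and is a subgradient of `f`. -/
def IsStochasticGradientOracle {n : ℕ} (X : Set (Euc n)) (f : Euc n → ℝ)
    (κ : Kernel (Euc n) (Euc n)) : Prop :=
  ∀ x ∈ X, Integrable (fun v : Euc n => v) (κ x) ∧ (∫ v, v ∂(κ x)) ∈ subdifferential X f x

/-- Pointwise bounded stochastic gradients: `ℓ` is continuous on `X`, and the answer of the oracle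
to a query at `x ∈ X` has norm at most `ℓ x` almost surely. -/
structure PointwiseBounded {n : ℕ} (X : Set (Euc n)) (κ : Kernel (Euc n) (Euc n))
    (ℓ : Euc n → ℝ) : Prop where
  continuousOn : ContinuousOn ℓ X
  bound : ∀ x ∈ X, ∀ᵐ v ∂(κ x), ‖v‖ ≤ ℓ x

/-- `p` is the Euclidean projection of `y` onto `X`. -/
def IsProjection {n : ℕ} (X : Set (Euc n)) (y p : Euc n) : Prop :=
  p ∈ X ∧ ∀ z ∈ X, ‖y - p‖ ≤ ‖y - z‖

/-- `max_{k ≤ t} a k`. -/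
noncomputable def runningMax (a : ℕ → ℝ) (t : ℕ) : ℝ :=
  (Finset.range (t + 1)).sup' Finset.nonempty_range_add_one a

/-- `r̄ₜ = max_{k ≤ t} ‖x k - x 0‖ ∨ rε`. -/
noncomputable def rbar {n : ℕ} (rε : ℝ) (x : ℕ → Euc n) (t : ℕ) : ℝ :=
  max (runningMax (fun k => ‖x k - x 0‖) t) rε

/-- `Gₜ = ∑_{k ≤ t} ‖g k‖ ^ 2`. -/
noncomputable def gradSum {n : ℕ} (g : ℕ → Euc n) (t : ℕ) : ℝ :=
  ∑ k ∈ Finset.range (t + 1), ‖g k‖ ^ 2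

/-- `L̄ₜ = max_{k ≤ t} ℓ (x k)`. -/
noncomputable def Lbar {n : ℕ} (ℓ : Euc n → ℝ) (x : ℕ → Euc n) (t : ℕ) : ℝ :=
  runningMax (fun k => ℓ (x k)) t

/-- The average of `x 0, …, x (t - 1)` with weights `r̄₀, …, r̄ₜ₋₁` (for `t ≥ 1`). -/
noncomputable def xbar {n : ℕ} (rε : ℝ) (x : ℕ → Euc n) (t : ℕ) : Euc n :=
  (∑ k ∈ Finset.range t, rbar rε x k)⁻¹ • ∑ k ∈ Finset.range t, rbar rε x k • x k

/-- `θ_{t,δ} = log (60 log (6 t) / δ)`. -/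
noncomputable def theta (t : ℕ) (δ : ℝ) : ℝ :=
  Real.log (60 * Real.log (6 * (t : ℝ)) / δ)

/-- The σ-algebra generated by `g 0, …, g (t - 1)`. -/
@[reducible] def history {Ω : Type*} {n : ℕ} (g : ℕ → Ω → Euc n) (t : ℕ) : MeasurableSpace Ω :=
  ⨆ k ∈ Finset.range t, MeasurableSpace.comap (g k) inferInstance

/-- `g t` is the answer of the oracle `κ` to the query `x t`, for every `t`: the conditional law of
`g t` given `g 0, …, g (t - 1)` is `κ (x t)`. -/
structure IsOracleAnswer {Ω : Type*} [MeasurableSpace Ω] {n : ℕ} (P : Measure Ω)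
    (κ : Kernel (Euc n) (Euc n)) (x g : ℕ → Ω → Euc n) : Prop where
  measurable : ∀ t, Measurable (g t)
  condLaw : ∀ (t : ℕ) (A : Set Ω), MeasurableSet[history g t] A →
    ∀ B : Set (Euc n), MeasurableSet B →
      P (A ∩ g t ⁻¹' B) = ∫⁻ ω in A, κ (x t ω) B ∂P

/-- Projected SGD `x (t + 1) = Proj_X (x t - η t • g t)` started at `x₀`. -/
structure IsProjectedSGD {Ω : Type*} {n : ℕ} (X : Set (Euc n)) (x₀ : Euc n)
    (η : ℕ → Ω → ℝ) (x g : ℕ → Ω → Euc n) : Prop where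
  init : ∀ ω, x 0 ω = x₀
  step : ∀ t ω, IsProjection X (x t ω - η t ω • g t ω) (x (t + 1) ω)

/-- The step sizes `η` are DoG-like with denominators `√(G' t)`: `η t = r̄ₜ / √(G' t)`, where `G'`
is (almost surely) positive, nondecreasing and at least `Gₜ`, and `G' t` depends only on
`g 0, …, g t` (the initial point is deterministic). -/
structure IsDoGLike {Ω : Type*} [MeasurableSpace Ω] {n : ℕ} (P : Measure Ω) (rε : ℝ)
    (x g : ℕ → Ω → Euc n) (G' η : ℕ → Ω → ℝ) : Prop where
  step_eq : ∀ t ω, η t ω = rbar rε (fun k => x k ω) t / √(G' t ω)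
  adapted : ∀ t, Measurable[history g (t + 1)] (G' t)
  pos : ∀ᵐ ω ∂P, ∀ t, 0 < G' t ω
  monotone : ∀ᵐ ω ∂P, Monotone fun t => G' t ω
  gradSum_le : ∀ᵐ ω ∂P, ∀ t, gradSum (fun k => g k ω) t ≤ G' t ω

end DoG

namespace DoG

/-! ### Deterministic inequalities -/

/-! By convexity (`gap_mul_sum_le`) the gap times `∑ r̄ₖ` is at most the weighted regret `∑ r̄ₖ ⟨mₖ,
xₖ - x⋆⟩`, where `mₖ` is the conditional mean of `gₖ`. Replacing `mₖ` by `gₖ` leaves a pathwise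
regret and a noise term.

The regret is deterministic (`weighted_regret_le`): the weight `r̄ₖ` cancels the numerator of the
step size, so the squared distances to `x⋆` carry the nondecreasing weights `√G'ₖ` and can be summed
by parts.

For the noise, `xₖ - x⋆` is divided by `L (d₀ + r̄ₖ)`, giving predictable directions `wₖ` of norm at
most `1 / L`. The factors taken out, `r̄ₖ (d₀ + r̄ₖ)`, are nondecreasing, so summation by parts
again reduces everything to a uniform bound on the partial sums `S` of `⟨gₖ - mₖ, wₖ⟩`. With `Q = ∑
⟨gₖ, wₖ⟩²`, `exp (s S - s² Q)` is a supermartingale for `|s| ≤ 1/2`. Ville's inequality and a union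
over `s = ±2^-(j+1)` give `dyadic_tail`; choosing `j` on the sample path (`exists_scale`) gives `|S|
≤ 8 √(Q θ + θ²)`, and `L² Q ≤ G` brings back the observed gradients. -/

/-- Summation by parts: an upper bound for a monotonically weighted telescoping sum. -/
theorem sum_mul_sub_le {a u : ℕ → ℝ} {D : ℝ} {t : ℕ} (ha : Monotone a) (ha0 : 0 ≤ a 0)
    (hu : ∀ k ≤ t + 1, u k ≤ D) :
    ∑ k ∈ Finset.range (t + 1), a k * (u k - u (k + 1)) ≤ a t * (D - u (t + 1)) := by
  induction t with
  | zero => simpa using mul_le_mul_of_nonneg_left (by linarith [hu 0 (by simp)]) ha0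
  | succ t ih =>
    rw [Finset.sum_range_succ]
    have h1 := ih fun k hk => hu k (by omega)
    have h2 := mul_le_mul_of_nonneg_right (ha t.le_succ) (sub_nonneg.2 (hu (t + 1) (by omega)))
    simp only [Nat.succ_eq_add_one] at h2
    linarith

/-- Each term is at most twice an increment of `√G`, by factoring `a = (√(G + a) - √G) (√(G + a) +
√G)`, so the sum telescopes. -/
theorem sum_sq_div_sqrt_le {n : ℕ} {g : ℕ → Euc n} {G' : ℕ → ℝ} (hpos : ∀ t, 0 < G' t)
    (hle : ∀ t, gradSum g t ≤ G' t) (t : ℕ) :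
    ∑ k ∈ Finset.range (t + 1), ‖g k‖ ^ 2 / √(G' k) ≤ 2 * √(gradSum g t) := by
  have key : ∀ G a b : ℝ, 0 ≤ G → 0 ≤ a → 0 < b → G + a ≤ b →
      a / √b ≤ 2 * (√(G + a) - √G) := by
    intro G a b hG ha hb hab
    rw [div_le_iff₀ (Real.sqrt_pos.2 hb)]
    have h1 := Real.sq_sqrt hG
    have h2 := Real.sq_sqrt (add_nonneg hG ha)
    have h3 := Real.sqrt_le_sqrt hab
    have h4 := Real.sqrt_le_sqrt (le_add_of_nonneg_right ha : G ≤ G + a)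
    nlinarith [mul_nonneg (sub_nonneg.2 h4) (sub_nonneg.2 h3)]
  have hG : ∀ t, 0 ≤ gradSum g t := fun t => Finset.sum_nonneg fun _ _ => by positivity
  induction t with
  | zero =>
    have := key 0 (‖g 0‖ ^ 2) (G' 0) le_rfl (by positivity) (hpos 0)
      (by simpa [gradSum] using hle 0)
    simpa [gradSum] using this
  | succ t ih =>
    have hs : gradSum g (t + 1) = gradSum g t + ‖g (t + 1)‖ ^ 2 := Finset.sum_range_succ _ _
    have := key (gradSum g t) (‖g (t + 1)‖ ^ 2) (G' (t + 1)) (hG t) (by positivity) (hpos _)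
      (hs ▸ hle _)
    rw [Finset.sum_range_succ, hs]
    linarith

/-- Turns an exponential with an empirical quadratic compensator into an affine function, whose
expectation is explicit. -/
theorem exp_sub_sq_le {z : ℝ} (hz : -(1 / 2) ≤ z) : Real.exp (z - z ^ 2) ≤ 1 + z := by
  rcases le_total z 0 with h0 | h0
  -- The second-order term is needed: `1 + u ≤ exp u` with `u = z² - z` would only give `1 + z³`,
  -- which is below `1` for `z < 0`.
  · have h1 : Real.exp (-(z - z ^ 2)) ≥ 1 + (-(z - z ^ 2)) + (-(z - z ^ 2)) ^ 2 / 2 :=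
      Real.quadratic_le_exp_of_nonneg (by nlinarith)
    have h2 : (1 + z) * Real.exp (-(z - z ^ 2)) ≥ 1 := by
      have h3 : 1 ≤ (1 + z) * (1 + (-(z - z ^ 2)) + (-(z - z ^ 2)) ^ 2 / 2) := by
        nlinarith [mul_nonneg (sq_nonneg z) (by linarith : 0 ≤ z + 1 / 2),
          mul_nonneg (mul_nonneg (sq_nonneg z) (sq_nonneg z)) (by linarith : 0 ≤ z + 1 / 2),
          mul_nonneg (sq_nonneg z) (neg_nonneg.2 h0)]
      nlinarith [mul_le_mul_of_nonneg_left h1 (by linarith : 0 ≤ 1 + z)]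
    rw [Real.exp_neg] at h2
    rwa [ge_iff_le, ← div_eq_mul_inv, le_div_iff₀ (Real.exp_pos _), one_mul] at h2
  · rcases le_total z 1 with h1 | h1
    · have h2 : 0 ≤ z - z ^ 2 := by nlinarith
      have h3 : z - z ^ 2 ≤ Real.log (1 + z) := by
        have := Real.le_log_one_add_of_nonneg h0
        refine le_trans ?_ this
        rw [le_div_iff₀ (by linarith)]
        nlinarith [sq_nonneg z, mul_nonneg (sq_nonneg z) h0]
      rw [← Real.exp_log (show 0 < 1 + z by linarith)]
      exact Real.exp_le_exp.2 h3
    · exact (Real.exp_le_one_iff.2 (by nlinarith)).trans (by linarith)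

/-! ### Projections onto convex sets -/

theorem IsProjection.inner_le_zero {n : ℕ} {X : Set (Euc n)} (hX : Convex ℝ X) {y p z : Euc n}
    (h : IsProjection X y p) (hz : z ∈ X) : inner ℝ (y - p) (z - p) ≤ 0 := by
  have : Nonempty X := ⟨⟨p, h.1⟩⟩
  refine (norm_eq_iInf_iff_real_inner_le_zero hX h.1).1 ?_ z hz
  refine le_antisymm (le_ciInf fun w => h.2 w w.2) ?_
  exact ciInf_le (f := fun w : X => ‖y - w‖) ⟨0, by rintro _ ⟨w, rfl⟩; exact norm_nonneg _⟩
    ⟨p, h.1⟩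

/-- Add the variational inequalities at `p` and `p'`, then apply Cauchy–Schwarz. Taking `y = y'`
also gives uniqueness of the projection. -/
theorem IsProjection.norm_sub_le {n : ℕ} {X : Set (Euc n)} (hX : Convex ℝ X) {y p y' p' : Euc n}
    (h : IsProjection X y p) (h' : IsProjection X y' p') : ‖p - p'‖ ≤ ‖y - y'‖ := by
  have h1 := h.inner_le_zero hX h'.1
  have h2 := h'.inner_le_zero hX h.1
  have h3 : ‖p - p'‖ ^ 2 ≤ inner ℝ (y - y') (p - p') := by
    rw [← real_inner_self_eq_norm_sq]
    simp only [inner_sub_left, inner_sub_right] at h1 h2 ⊢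
    linarith
  have h4 := real_inner_le_norm (y - y') (p - p')
  by_contra! hlt
  nlinarith [norm_nonneg (y - y')]

theorem isProjection_self {n : ℕ} {X : Set (Euc n)} {z : Euc n} (hz : z ∈ X) :
    IsProjection X z z := ⟨hz, fun w _ => by simp⟩

/-- The iterates are specified only through a predicate; uniqueness and nonexpansiveness make them
values of a 1-Lipschitz map, hence measurable functions of the past. -/
theorem exists_measurable_projection {n : ℕ} {X : Set (Euc n)} (hX : Convex ℝ X)
    (hc : IsClosed X) (hne : X.Nonempty) :
    ∃ proj : Euc n → Euc n, Measurable proj ∧ ∀ y p, IsProjection X y p → p = proj y := by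
  have hex : ∀ y, ∃ p, IsProjection X y p := fun y => by
    obtain ⟨p, hp, h⟩ := exists_norm_eq_iInf_of_complete_convex hne hc.isComplete hX y
    refine ⟨p, hp, fun z hz => h ▸ ?_⟩
    exact ciInf_le (f := fun w : X => ‖y - w‖)
      ⟨0, by rintro _ ⟨w, rfl⟩; exact norm_nonneg _⟩ ⟨z, hz⟩
  choose proj hproj using hex
  refine ⟨proj, ?_, fun y p h => ?_⟩
  · refine (LipschitzWith.of_dist_le_mul (K := 1) fun y y' => ?_).continuous.measurable
    simpa [dist_eq_norm] using (hproj y).norm_sub_le hX (hproj y')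
  · simpa [sub_eq_zero] using h.norm_sub_le hX (hproj y)

/-! ### The running maximum -/

theorem le_runningMax (a : ℕ → ℝ) {k t : ℕ} (h : k ≤ t) : a k ≤ runningMax a t :=
  Finset.le_sup' a (by simpa using Nat.lt_succ_of_le h)

theorem runningMax_mono (a : ℕ → ℝ) : Monotone (runningMax a) := fun s t h =>
  Finset.sup'_le _ _ fun k hk => le_runningMax a (by simp at hk; omega)

theorem rbar_mono {n : ℕ} (rε : ℝ) (x : ℕ → Euc n) : Monotone (rbar rε x) := fun _ _ h =>
  max_le_max (runningMax_mono _ h) le_rfl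

theorem norm_sub_le_rbar {n : ℕ} (rε : ℝ) (x : ℕ → Euc n) {k t : ℕ} (h : k ≤ t) :
    ‖x k - x 0‖ ≤ rbar rε x t :=
  (le_runningMax (fun k => ‖x k - x 0‖) h).trans (le_max_left _ _)

theorem rbar_pos {n : ℕ} {rε : ℝ} (h : 0 < rε) (x : ℕ → Euc n) (t : ℕ) : 0 < rbar rε x t :=
  h.trans_le (le_max_right _ _)

theorem norm_sub_le_add_rbar {n : ℕ} (rε : ℝ) (x : ℕ → Euc n) (z : Euc n) {k t : ℕ} (h : k ≤ t) :
    ‖x k - z‖ ≤ ‖x 0 - z‖ + rbar rε x t := by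
  have h1 := norm_sub_le_rbar rε x h
  have h2 := norm_sub_le_norm_sub_add_norm_sub (x k) (x 0) z
  linarith

theorem measurable_rbar {Ω : Type*} [MeasurableSpace Ω] {n : ℕ} (rε : ℝ) {x : ℕ → Ω → Euc n}
    {t : ℕ} (hx : ∀ k ≤ t, Measurable (x k)) :
    Measurable fun ω => rbar rε (fun k => x k ω) t := by
  refine Measurable.max ?_ measurable_const
  exact Finset.measurable_range_sup'' fun k hk => ((hx k hk).sub (hx 0 (by omega))).norm

/-- The weighted regret of projected SGD with DoG-like step sizes. -/
theorem weighted_regret_le {n : ℕ} {X : Set (Euc n)} (hX : Convex ℝ X) {rε : ℝ} (hr : 0 < rε)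
    {x g : ℕ → Euc n} {G' : ℕ → ℝ} {z : Euc n} (hz : z ∈ X)
    (hstep : ∀ t, IsProjection X (x t - (rbar rε x t / √(G' t)) • g t) (x (t + 1)))
    (hpos : ∀ t, 0 < G' t) (hmono : Monotone G') (hle : ∀ t, gradSum g t ≤ G' t) (t : ℕ) :
    ∑ k ∈ Finset.range (t + 1), rbar rε x k * inner ℝ (g k) (x k - z) ≤
      3 * (rbar rε x (t + 1) * (‖x 0 - z‖ + rbar rε x (t + 1))) * √(G' t) := by
  set R := rbar rε x (t + 1) with hR
  have hRpos : 0 < R := rbar_pos hr x _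
  have hterm : ∀ k ∈ Finset.range (t + 1), rbar rε x k * inner ℝ (g k) (x k - z) ≤
      1 / 2 * (√(G' k) * (‖x k - z‖ ^ 2 - ‖x (k + 1) - z‖ ^ 2)) +
        1 / 2 * R ^ 2 * (‖g k‖ ^ 2 / √(G' k)) := by
    intro k hk
    have hs : 0 < √(G' k) := Real.sqrt_pos.2 (hpos k)
    have hrk : 0 < rbar rε x k := rbar_pos hr x k
    have hrR : rbar rε x k ≤ R := rbar_mono rε x (by simp at hk; omega)
    have h1 := (hstep k).norm_sub_le hX (isProjection_self hz)
    have h2 : ‖x (k + 1) - z‖ ^ 2 ≤ ‖x k - z‖ ^ 2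
        - 2 * (rbar rε x k / √(G' k)) * inner ℝ (g k) (x k - z)
        + (rbar rε x k / √(G' k)) ^ 2 * ‖g k‖ ^ 2 := by
      have h3 := pow_le_pow_left₀ (norm_nonneg _) h1 2
      rw [show x k - (rbar rε x k / √(G' k)) • g k - z
        = (x k - z) - (rbar rε x k / √(G' k)) • g k by abel, norm_sub_sq_real (x k - z), norm_smul,
        inner_smul_right, mul_pow, Real.norm_eq_abs, sq_abs, real_inner_comm (g k)] at h3
      linarith
    have h4 : √(G' k) * (2 * (rbar rε x k / √(G' k)) * inner ℝ (g k) (x k - z))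
        = 2 * (rbar rε x k * inner ℝ (g k) (x k - z)) := by field_simp
    have h5 : √(G' k) * ((rbar rε x k / √(G' k)) ^ 2 * ‖g k‖ ^ 2)
        = rbar rε x k ^ 2 * (‖g k‖ ^ 2 / √(G' k)) := by field_simp
    have h6 : rbar rε x k ^ 2 * (‖g k‖ ^ 2 / √(G' k)) ≤ R ^ 2 * (‖g k‖ ^ 2 / √(G' k)) := by
      gcongr
    have h7 := mul_le_mul_of_nonneg_left h2 hs.le
    linarith
  obtain ⟨s, hs, hmax⟩ := Finset.exists_max_image (Finset.range (t + 2)) (fun k => ‖x k - z‖)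
    ⟨0, by simp⟩
  simp only [Finset.mem_range] at hs hmax
  have h1 := sum_mul_sub_le (a := fun k => √(G' k)) (u := fun k => ‖x k - z‖ ^ 2)
    (D := ‖x s - z‖ ^ 2) (t := t) (fun i j h => Real.sqrt_le_sqrt (hmono h))
    (Real.sqrt_nonneg _) fun k hk => by
      have := hmax k (by omega)
      gcongr
  -- Factor the difference of squares: the difference of distances is at most `2 * R`, independently
  -- of `z`, because both iterates lie within `R` of `x 0`. Bounding each square separately would
  -- lose the factor `R`.
  have h2 : ‖x s - z‖ ^ 2 - ‖x (t + 1) - z‖ ^ 2 ≤ 4 * (R * (‖x 0 - z‖ + R)) := by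
    have e1 : ‖x s - z‖ ≤ ‖x 0 - z‖ + R := norm_sub_le_add_rbar rε x z (by omega)
    have e2 := hmax (t + 1) (by omega)
    have e3 : ‖x s - z‖ - ‖x (t + 1) - z‖ ≤ 2 * R := by
      have a1 := norm_sub_le_rbar rε x (show s ≤ t + 1 by omega)
      have a2 := norm_sub_le_rbar rε x (le_refl (t + 1))
      have a3 := norm_sub_le_norm_sub_add_norm_sub (x s) (x 0) (x (t + 1))
      have a4 := norm_sub_le_norm_sub_add_norm_sub (x s) (x (t + 1)) z
      rw [norm_sub_rev (x 0)] at a3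
      linarith
    have e4 : ‖x s - z‖ ^ 2 - ‖x (t + 1) - z‖ ^ 2
        = (‖x s - z‖ - ‖x (t + 1) - z‖) * (‖x s - z‖ + ‖x (t + 1) - z‖) := by ring
    have e5 := mul_le_mul e3 (show ‖x s - z‖ + ‖x (t + 1) - z‖ ≤ 2 * (‖x 0 - z‖ + R) by linarith)
      (by positivity) (by positivity)
    linarith
  have h3 := sum_sq_div_sqrt_le hpos hle t
  have h4 := Real.sqrt_le_sqrt (hle t)
  have h5 := Finset.sum_le_sum hterm
  rw [Finset.sum_add_distrib, ← Finset.mul_sum, ← Finset.mul_sum] at h5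
  have h6 := mul_le_mul_of_nonneg_left h2 (Real.sqrt_nonneg (G' t))
  have h7 := mul_le_mul_of_nonneg_left (h3.trans (mul_le_mul_of_nonneg_left h4 (by norm_num)))
    (by positivity : 0 ≤ 1 / 2 * R ^ 2)
  have h8 : 0 ≤ R * ‖x 0 - z‖ * √(G' t) := by positivity
  nlinarith

/-! ### Conditional laws and time-uniform concentration -/

/-- If the conditional law of `g` given `m` is `κ x`, then functions of `g` and of an
`m`-measurable variable `Z` that determines `x` can be integrated iteratively. -/
theorem lintegral_eq_of_condLaw {Ω E E' γ : Type*} {m m0 : MeasurableSpace Ω}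
    [MeasurableSpace E] [MeasurableSpace E'] [MeasurableSpace γ] (hm : m ≤ m0) {P : Measure Ω}
    [IsFiniteMeasure P] {κ : Kernel E' E} [IsMarkovKernel κ] {x : Ω → E'} {g : Ω → E}
    (hg : Measurable g)
    (hcond : ∀ A, MeasurableSet[m] A → ∀ B, MeasurableSet B →
      P (A ∩ g ⁻¹' B) = ∫⁻ ω in A, κ (x ω) B ∂P)
    {Z : Ω → γ} (hZ : Measurable[m] Z) {ψ : γ → E'} (hψ : Measurable ψ) (hx : ∀ ω, x ω = ψ (Z ω))
    {φ : γ × E → ENNReal} (hφ : Measurable φ) :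
    ∫⁻ ω, φ (Z ω, g ω) ∂P = ∫⁻ ω, ∫⁻ v, φ (Z ω, v) ∂κ (x ω) ∂P := by
  have hZ0 : Measurable Z := hZ.mono hm le_rfl
  have hpair : Measurable fun ω => (Z ω, g ω) := hZ0.prodMk hg
  have hlaw : P.map (fun ω => (Z ω, g ω)) = (P.map Z) ⊗ₘ (κ.comap ψ hψ) := by
    refine Measure.ext_prod fun {s t} hs ht => ?_
    rw [Measure.compProd_apply_prod hs ht, Measure.map_apply hpair (hs.prod ht),
      setLIntegral_map hs (Kernel.measurable_coe _ ht) hZ0]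
    simp only [Kernel.comap_apply, ← hx]
    exact hcond _ (hZ hs) _ ht
  rw [← lintegral_map hφ hpair, hlaw, Measure.lintegral_compProd hφ,
    lintegral_map (Measurable.lintegral_kernel_prod_right' hφ) hZ0]
  simp [hx]

/-- Ville's maximal inequality for a product of conditionally contracting factors. -/
theorem ville_prod {Ω : Type*} {m0 : MeasurableSpace Ω} {P : Measure Ω} [IsProbabilityMeasure P]
    {ℱ : Filtration ℕ m0} {D : ℕ → Ω → ENNReal} (hD : ∀ t, Measurable[ℱ (t + 1)] (D t))
    (hint : ∀ t, ∀ a : Ω → ENNReal, Measurable[ℱ t] a → ∫⁻ ω, a ω * D t ω ∂P ≤ ∫⁻ ω, a ω ∂P)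
    (c : ENNReal) (T : ℕ) :
    c * P {ω | ∃ t ≤ T, c ≤ ∏ k ∈ Finset.range t, D k ω} ≤ 1 := by
  set M : ℕ → Ω → ENNReal := fun t ω => ∏ k ∈ Finset.range t, D k ω with hM
  have hMm : ∀ t, Measurable[ℱ t] (M t) := fun t => by
    refine Finset.measurable_fun_prod (Finset.range t) fun k hk => ?_
    exact (hD k).mono (ℱ.mono (by simp at hk; omega)) le_rfl
  set B : ℕ → Set Ω := fun T => {ω | ∃ t ≤ T, c ≤ M t ω} with hB
  have hBm : ∀ t, MeasurableSet[ℱ t] (B t) := fun t => by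
    have : B t = ⋃ s ∈ Finset.range (t + 1), {ω | c ≤ M s ω} := by
      ext ω; simp [hB]
    rw [this]
    refine @Finset.measurableSet_biUnion Ω ℕ (ℱ t) _ _ fun s hs => ?_
    have h1 : MeasurableSet[ℱ s] (M s ⁻¹' Set.Ici c) := hMm s measurableSet_Ici
    exact ℱ.mono (by simp at hs; omega) _ h1
  have hstep : ∀ t, B (t + 1) = B t ∪ ((B t)ᶜ ∩ {ω | c ≤ M (t + 1) ω}) := fun t => by
    ext ω
    simp only [hB, Set.mem_union, Set.mem_inter_iff, Set.mem_compl_iff, Set.mem_ofPred_eq]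
    constructor
    · rintro ⟨s, hs, h⟩
      by_cases hb : ∃ t' ≤ t, c ≤ M t' ω
      · exact Or.inl hb
      · rcases Nat.of_le_succ hs with h' | h'
        · exact Or.inl ⟨s, h', h⟩
        · exact Or.inr ⟨hb, by rwa [h'] at h⟩
    · rintro (⟨s, hs, h⟩ | ⟨_, h⟩)
      · exact ⟨s, by omega, h⟩
      · exact ⟨t + 1, le_rfl, h⟩
  have hBm0 : ∀ t, MeasurableSet (B t) := fun t => ℱ.le t _ (hBm t)
  have hMm0 : ∀ t, Measurable (M t) := fun t => (hMm t).mono (ℱ.le t) le_rfl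
  -- The invariant is Markov's inequality for the product stopped at its first passage above `c`, so
  -- no stopping time has to be introduced.
  have key : ∀ t, c * P (B t) + ∫⁻ ω in (B t)ᶜ, M t ω ∂P ≤ 1 := by
    intro t
    induction t with
    | zero =>
      by_cases hc : c ≤ 1
      · have : B 0 = Set.univ := by ext ω; simp [hB, hM, hc]
        simp [this, hc]
      · have : B 0 = ∅ := by ext ω; simpa [hB, hM] using hc
        simp [this, hM]
    | succ t ih =>
      refine le_trans ?_ ih
      have hN : MeasurableSet {ω | c ≤ M (t + 1) ω} := hMm0 (t + 1) measurableSet_Ici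
      have hle : ∫⁻ ω in (B t)ᶜ, M (t + 1) ω ∂P ≤ ∫⁻ ω in (B t)ᶜ, M t ω ∂P := by
        rw [← lintegral_indicator (hBm0 t).compl, ← lintegral_indicator (hBm0 t).compl]
        refine le_trans (le_of_eq (lintegral_congr fun ω => ?_)) (hint t ((B t)ᶜ.indicator (M t))
          ((hMm t).indicator (hBm t).compl))
        by_cases hω : ω ∈ (B t)ᶜ
        · simp only [Set.indicator_of_mem hω, hM, Finset.prod_range_succ]
        · simp only [Set.indicator_of_notMem hω, zero_mul]
      rw [hstep t, measure_union (Set.disjoint_left.2 fun ω h h' => h'.1 h)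
        ((hBm0 t).compl.inter hN), mul_add, add_assoc]
      refine add_le_add le_rfl (le_trans ?_ hle)
      rw [← lintegral_inter_add_sdiff _ (B t)ᶜ hN]
      refine add_le_add ?_ (le_of_eq ?_)
      · rw [← setLIntegral_const]
        exact setLIntegral_mono' ((hBm0 t).compl.inter hN) fun ω h => h.2
      · congr 2
        ext ω; simp only [Set.mem_compl_iff, Set.mem_union, Set.mem_inter_iff, Set.mem_sdiff]; tauto
  exact le_trans le_self_add (key T)

/-- The exponential moment bound behind the empirical Bernstein inequality. -/
theorem lintegral_exp_le {E : Type*} [MeasurableSpace E] {μ : Measure E} [IsProbabilityMeasure μ]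
    {y : E → ℝ} (hy : Integrable y μ) (hb : ∀ᵐ v ∂μ, |y v| ≤ 1) {s : ℝ} (hs : |s| ≤ 1 / 2) :
    ∫⁻ v, ENNReal.ofReal (Real.exp (s * (y v - ∫ u, y u ∂μ) - s ^ 2 * y v ^ 2)) ∂μ ≤ 1 := by
  set e := ∫ u, y u ∂μ with he
  have h1 : ∀ᵐ v ∂μ, Real.exp (s * (y v - e) - s ^ 2 * y v ^ 2)
      ≤ Real.exp (-(s * e)) * (1 + s * y v) ∧ 0 ≤ 1 + s * y v := by
    filter_upwards [hb] with v hv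
    have h2 : |s * y v| ≤ 1 / 2 := by
      rw [abs_mul]
      calc |s| * |y v| ≤ 1 / 2 * 1 := mul_le_mul hs hv (abs_nonneg _) (by norm_num)
        _ = 1 / 2 := by norm_num
    have h3 := exp_sub_sq_le (neg_le_of_abs_le h2)
    refine ⟨?_, by linarith [neg_le_of_abs_le h2]⟩
    -- With `z = s * y v`, the compensator is the uncentred `z ^ 2`; after integration only `exp
    -- (-(s * e)) * (1 + s * e) ≤ 1` is left.
    rw [show s * (y v - e) - s ^ 2 * y v ^ 2 = -(s * e) + (s * y v - (s * y v) ^ 2) by ring,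
      Real.exp_add]
    exact mul_le_mul_of_nonneg_left h3 (Real.exp_pos _).le
  have hint : Integrable (fun v => Real.exp (-(s * e)) * (1 + s * y v)) μ :=
    ((integrable_const 1).add (hy.const_mul s)).const_mul _
  calc ∫⁻ v, ENNReal.ofReal (Real.exp (s * (y v - e) - s ^ 2 * y v ^ 2)) ∂μ
      ≤ ∫⁻ v, ENNReal.ofReal (Real.exp (-(s * e)) * (1 + s * y v)) ∂μ :=
        lintegral_mono_ae (h1.mono fun v h => ENNReal.ofReal_le_ofReal h.1)
    _ = ENNReal.ofReal (∫ v, Real.exp (-(s * e)) * (1 + s * y v) ∂μ) :=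
        (ofReal_integral_eq_lintegral_ofReal hint
          (h1.mono fun v h => mul_nonneg (Real.exp_pos _).le h.2)).symm
    _ ≤ 1 := by
      rw [integral_const_mul, integral_add (integrable_const _) (hy.const_mul s),
        integral_const_mul, ← he]
      simp only [integral_const, probReal_univ, smul_eq_mul, mul_one]
      rw [← ENNReal.ofReal_one]
      refine ENNReal.ofReal_le_ofReal ?_
      have := mul_le_mul_of_nonneg_left (Real.add_one_le_exp (s * e)) (Real.exp_pos (-(s * e))).le
      rwa [← Real.exp_add, neg_add_cancel, Real.exp_zero, add_comm] at this

theorem history_le {Ω : Type*} [m0 : MeasurableSpace Ω] {n : ℕ} {g : ℕ → Ω → Euc n}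
    (hg : ∀ t, Measurable (g t)) (t : ℕ) : history g t ≤ m0 :=
  iSup₂_le fun k _ => (hg k).comap_le

theorem history_mono {Ω : Type*} {n : ℕ} (g : ℕ → Ω → Euc n) : Monotone (history g) :=
  fun _ _ h => iSup₂_mono' fun k hk =>
    ⟨k, by simp only [Finset.mem_range] at hk ⊢; omega, le_rfl⟩

theorem measurable_history {Ω : Type*} {n : ℕ} (g : ℕ → Ω → Euc n) {k t : ℕ} (h : k < t) :
    Measurable[history g t] (g k) :=
  Measurable.mono (comap_measurable (g k))
    (le_iSup₂ (f := fun k (_ : k ∈ Finset.range t) => MeasurableSpace.comap (g k) inferInstance)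
      k (Finset.mem_range.2 h)) le_rfl

/-- The filtration generated by the answers of the oracle. -/
def historyFiltration {Ω : Type*} [m0 : MeasurableSpace Ω] {n : ℕ} {g : ℕ → Ω → Euc n}
    (hg : ∀ t, Measurable (g t)) : Filtration ℕ m0 where
  seq := history g
  mono' := history_mono g
  le' := history_le hg

/-- The mean of the answer of the oracle `κ` to the query `x`. -/
noncomputable def mean {n : ℕ} (κ : Kernel (Euc n) (Euc n)) (x : Euc n) : Euc n := ∫ v, v ∂κ x

theorem measurable_mean {n : ℕ} (κ : Kernel (Euc n) (Euc n)) [IsMarkovKernel κ] :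
    Measurable (mean κ) :=
  (StronglyMeasurable.integral_kernel (κ := κ) stronglyMeasurable_id).measurable

section Concentration

variable {Ω : Type*} [MeasurableSpace Ω] {n : ℕ} {P : Measure Ω} [IsProbabilityMeasure P]
  {κ : Kernel (Euc n) (Euc n)} [IsMarkovKernel κ] {x g w : ℕ → Ω → Euc n}

/-- The exponential of an empirically compensated martingale exceeds `exp b` at some time with
probability at most `exp (-b)`. -/
theorem IsOracleAnswer.exp_tail (h : IsOracleAnswer P κ x g)
    (hx : ∀ t, Measurable[history g t] (x t)) (hw : ∀ t, Measurable[history g t] (w t))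
    (hint : ∀ t ω, Integrable (fun v : Euc n => v) (κ (x t ω)))
    (hb : ∀ t ω, ∀ᵐ v ∂κ (x t ω), |inner ℝ v (w t ω)| ≤ 1) {s : ℝ} (hs : |s| ≤ 1 / 2) (b : ℝ)
    (T : ℕ) :
    P.real {ω | ∃ t ≤ T, b ≤ s * ∑ k ∈ Finset.range t, inner ℝ (g k ω - mean κ (x k ω)) (w k ω)
      - s ^ 2 * ∑ k ∈ Finset.range t, inner ℝ (g k ω) (w k ω) ^ 2} ≤ Real.exp (-b) := by
  set φ : (Euc n × Euc n) × Euc n → ENNReal := fun p => ENNReal.ofReal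
    (Real.exp (s * inner ℝ (p.2 - mean κ p.1.1) p.1.2 - s ^ 2 * inner ℝ p.2 p.1.2 ^ 2)) with hφ
  have hκ := measurable_mean κ
  have hφm : Measurable φ := by fun_prop
  set D : ℕ → Ω → ENNReal := fun t ω => φ ((x t ω, w t ω), g t ω) with hD
  have hville := ville_prod (P := P) (ℱ := historyFiltration h.measurable) (D := D)
    (fun t => hφm.comp <| Measurable.prodMk (Measurable.prodMk
      ((hx t).mono (history_mono g t.le_succ) le_rfl)
      ((hw t).mono (history_mono g t.le_succ) le_rfl)) (measurable_history g t.lt_succ_self))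
    (fun t a ha => ?_) (ENNReal.ofReal (Real.exp b)) T
  · have hset : {ω | ∃ t ≤ T, ENNReal.ofReal (Real.exp b) ≤ ∏ k ∈ Finset.range t, D k ω}
        = {ω | ∃ t ≤ T, b ≤ s * ∑ k ∈ Finset.range t, inner ℝ (g k ω - mean κ (x k ω)) (w k ω)
          - s ^ 2 * ∑ k ∈ Finset.range t, inner ℝ (g k ω) (w k ω) ^ 2} := by
      ext ω
      simp only [Set.mem_ofPred_eq, hD, hφ]
      refine exists_congr fun t => and_congr_right fun _ => ?_
      rw [← ENNReal.ofReal_prod_of_nonneg fun _ _ => (Real.exp_pos _).le,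
        ENNReal.ofReal_le_ofReal_iff (Finset.prod_nonneg fun _ _ => (Real.exp_pos _).le),
        ← Real.exp_sum, Real.exp_le_exp, Finset.sum_sub_distrib, ← Finset.mul_sum,
        ← Finset.mul_sum]
    rw [hset] at hville
    have := ENNReal.toReal_mono ENNReal.one_ne_top hville
    rw [ENNReal.toReal_mul, ENNReal.toReal_ofReal (Real.exp_pos _).le, ENNReal.toReal_one] at this
    rw [Real.exp_neg, ← one_div, le_div_iff₀ (Real.exp_pos b), mul_comm]
    exact this
  · have ha' : Measurable[history g t] a := ha
    -- The weight `a` is included in `Z`, so that it factors out of the inner integral over the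
    -- oracle's answer.
    have := lintegral_eq_of_condLaw (history_le h.measurable t) (h.measurable t) (h.condLaw t)
      (Z := fun ω => (a ω, (x t ω, w t ω))) (ha'.prodMk ((hx t).prodMk (hw t)))
      (ψ := fun z => z.2.1) (by fun_prop) (fun ω => rfl)
      (φ := fun p => p.1.1 * φ (p.1.2, p.2)) (by fun_prop)
    simp only at this
    rw [this]
    refine lintegral_mono fun ω => ?_
    rw [lintegral_const_mul _ (by fun_prop)]
    refine mul_le_of_le_one_right' ?_
    have hi : Integrable (fun v => (inner ℝ v (w t ω) : ℝ)) (κ (x t ω)) :=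
      (hint t ω).inner_const _
    have hm : (∫ v, (inner ℝ v (w t ω) : ℝ) ∂κ (x t ω)) = inner ℝ (mean κ (x t ω)) (w t ω) := by
      simp_rw [real_inner_comm (w t ω)]
      exact integral_inner (hint t ω) _
    have := lintegral_exp_le hi (hb t ω) hs
    rw [hm] at this
    simpa only [hφ, inner_sub_left] using this

end Concentration

/-! ### The noise at all scales and the bound on a sample path -/

theorem one_le_theta {t : ℕ} (ht : 1 ≤ t) {δ : ℝ} (h0 : 0 < δ) (h1 : δ < 1) : 1 ≤ theta t δ := by
  have ht' : (1 : ℝ) ≤ t := by exact_mod_cast ht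
  have h2 : 1 ≤ Real.log (6 * (t : ℝ)) := by
    rw [Real.le_log_iff_exp_le (by positivity)]
    linarith [Real.exp_one_lt_d9]
  rw [theta, Real.le_log_iff_exp_le (by positivity), le_div_iff₀ h0]
  nlinarith [Real.exp_one_lt_d9, Real.exp_pos 1]

/-- A dyadic scale balances the two terms of the exponential tail bound up to constants. -/
theorem exists_scale {t : ℕ} (ht : 1 ≤ t) {δ : ℝ} (h0 : 0 < δ) (h1 : δ < 1) {Q : ℝ} (hQ0 : 0 ≤ Q)
    (hQ : Q ≤ t) :
    ∃ j < 2 * t, Q / 2 ^ (j + 1) + 2 ^ (j + 1) * Real.log (2 * (j + 1) * (j + 2) / δ) ≤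
      8 * √(Q * theta t δ + theta t δ ^ 2) := by
  have ht' : (1 : ℝ) ≤ t := by exact_mod_cast ht
  have hθ := one_le_theta ht h0 h1
  set θ := theta t δ with hθdef
  have hp : 1 ≤ √θ := Real.one_le_sqrt.2 hθ
  -- The optimal `2 ^ m` is about `√(Q / θ)`; the maximum with `2` forces `m ≥ 1`, hence `s = 2 ^
  -- (-m) ≤ 1 / 2`.
  obtain ⟨m, hm1, hm2⟩ := exists_nat_pow_near (show (1 : ℝ) ≤ max 2 (√Q / √θ) from
    le_max_of_le_left one_le_two) one_lt_two
  obtain ⟨j, rfl⟩ : ∃ j, m = j + 1 := by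
    refine Nat.exists_eq_succ_of_ne_zero ?_
    rintro rfl
    simp at hm2
  have hpow : (0 : ℝ) < 2 ^ (j + 1) := by positivity
  have hx : max 2 (√Q / √θ) ≤ 2 * t := by
    refine max_le (by linarith) ?_
    have e1 : √Q / √θ ≤ √Q := div_le_self (Real.sqrt_nonneg _) hp
    have e2 : √Q ≤ t := Real.sqrt_le_iff.2 ⟨by linarith, by nlinarith⟩
    linarith
  have hj : j + 1 < 2 * t + 1 := by
    have e1 : ((2 ^ (j + 1) : ℕ) : ℝ) ≤ ((2 * t : ℕ) : ℝ) := by push_cast; exact hm1.trans hx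
    have e2 : 2 ^ (j + 1) ≤ 2 * t := by exact_mod_cast e1
    have e3 : j + 1 < 2 ^ (j + 1) := Nat.lt_two_pow_self
    omega
  refine ⟨j, by omega, ?_⟩
  have hlog1 : 1 ≤ Real.log (6 * (t : ℝ)) := by
    rw [Real.le_log_iff_exp_le (by positivity)]
    linarith [Real.exp_one_lt_d9]
  -- Only logarithmically many scales can be selected, so the union-bound cost `log (2 (j + 1) (j +
  -- 2) / δ)` is of iterated-logarithm order and is absorbed by `θ`.
  have hjlog : (j : ℝ) + 1 ≤ 2 * Real.log (6 * t) := by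
    have e1 := Real.log_le_log hpow (hm1.trans hx)
    rw [Real.log_pow] at e1
    push_cast at e1
    have e2 := Real.log_le_log (show (0 : ℝ) < 2 * t by linarith)
      (show (2 : ℝ) * t ≤ 6 * t by linarith)
    have e3 := Real.log_two_gt_d9
    nlinarith [(Nat.cast_nonneg j : (0 : ℝ) ≤ j)]
  have hlog : Real.log (2 * (j + 1) * (j + 2) / δ) ≤ 2 * θ := by
    rw [hθdef, theta, ← Nat.cast_two (R := ℝ), ← Real.log_pow]
    push_cast
    refine Real.log_le_log (by positivity) ?_
    rw [div_pow, div_le_div_iff₀ h0 (by positivity)]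
    have e0 : (0 : ℝ) ≤ j := Nat.cast_nonneg j
    have e1 : 2 * ((j : ℝ) + 1) * (j + 2) ≤ (60 * Real.log (6 * t)) ^ 2 := by nlinarith
    have e2 : δ ^ 2 ≤ δ := by nlinarith
    exact mul_le_mul e1 e2 (by positivity) (by positivity)
  have hA : Q / 2 ^ (j + 1) ≤ 2 * (√Q * √θ) := by
    have e1 := (le_max_right 2 (√Q / √θ)).trans hm2.le
    rw [div_le_iff₀ (by linarith), pow_succ] at e1
    rw [div_le_iff₀ hpow]
    nlinarith [Real.mul_self_sqrt hQ0, mul_le_mul_of_nonneg_left e1 (Real.sqrt_nonneg Q)]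
  have hB : (2 : ℝ) ^ (j + 1) * θ ≤ 2 * θ + √Q * √θ := by
    have e1 : max 2 (√Q / √θ) ≤ 2 + √Q / √θ := max_le (by linarith [show 0 ≤ √Q / √θ by positivity])
      (by linarith)
    have e2 : √Q / √θ * θ = √Q * √θ := by
      nth_rewrite 2 [← Real.mul_self_sqrt (show 0 ≤ θ by linarith)]
      field_simp
    have e3 := mul_le_mul_of_nonneg_right (hm1.trans e1) (show 0 ≤ θ by linarith)
    linarith
  have hC : √Q * √θ ≤ √(Q * θ + θ ^ 2) := by
    rw [← Real.sqrt_mul hQ0]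
    exact Real.sqrt_le_sqrt (by nlinarith)
  have hD : θ ≤ √(Q * θ + θ ^ 2) := Real.le_sqrt_of_sq_le (by nlinarith)
  have hE := mul_le_mul_of_nonneg_left hlog hpow.le
  linarith

/-- Telescoping: these are the weights that split `δ` among the scales. -/
theorem sum_inv_mul_le (J : ℕ) :
    ∑ j ∈ Finset.range J, (1 : ℝ) / ((j + 1) * (j + 2)) ≤ 1 - 1 / (J + 1) := by
  induction J with
  | zero => simp
  | succ J ih =>
    rw [Finset.sum_range_succ]
    refine (add_le_add_left ih _).trans (le_of_eq ?_)
    push_cast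
    field_simp
    ring

section Concentration

variable {Ω : Type*} [MeasurableSpace Ω] {n : ℕ} {P : Measure Ω} [IsProbabilityMeasure P]
  {κ : Kernel (Euc n) (Euc n)} [IsMarkovKernel κ] {x g w : ℕ → Ω → Euc n}

/-- The tail bound holds simultaneously at all dyadic scales. -/
theorem IsOracleAnswer.dyadic_tail (h : IsOracleAnswer P κ x g)
    (hx : ∀ t, Measurable[history g t] (x t)) (hw : ∀ t, Measurable[history g t] (w t))
    (hint : ∀ t ω, Integrable (fun v : Euc n => v) (κ (x t ω)))
    (hb : ∀ t ω, ∀ᵐ v ∂κ (x t ω), |inner ℝ v (w t ω)| ≤ 1) {δ : ℝ} (h0 : 0 < δ) (J T : ℕ) :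
    P.real {ω | ∃ j < J, ∃ t ≤ T,
      (∑ k ∈ Finset.range t, inner ℝ (g k ω) (w k ω) ^ 2) / 2 ^ (j + 1) +
        2 ^ (j + 1) * Real.log (2 * (j + 1) * (j + 2) / δ) <
      |∑ k ∈ Finset.range t, inner ℝ (g k ω - mean κ (x k ω)) (w k ω)|} ≤ δ := by
  set S : ℕ → Ω → ℝ := fun t ω =>
    ∑ k ∈ Finset.range t, inner ℝ (g k ω - mean κ (x k ω)) (w k ω) with hS
  set Q : ℕ → Ω → ℝ := fun t ω => ∑ k ∈ Finset.range t, inner ℝ (g k ω) (w k ω) ^ 2 with hQ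
  set b : ℕ → ℝ := fun j => Real.log (2 * (j + 1) * (j + 2) / δ) with hbdef
  set A : ℝ → ℕ → Set Ω := fun s j => {ω | ∃ t ≤ T, b j ≤ s * S t ω - s ^ 2 * Q t ω} with hA
  -- Half of the share of scale `j`, since each scale is used with both signs of `s`.
  have hexp : ∀ j, Real.exp (-b j) = δ / 2 * (1 / ((j + 1) * (j + 2))) := fun j => by
    rw [Real.exp_neg, Real.exp_log (by positivity)]
    field_simp
  have hinv : ∀ j : ℕ, |(1 : ℝ) / 2 ^ (j + 1)| ≤ 1 / 2 := fun j => by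
    rw [abs_of_pos (by positivity)]
    refine one_div_le_one_div_of_le (by norm_num) ?_
    rw [pow_succ]
    linarith [one_le_pow₀ (n := j) (one_le_two : (1 : ℝ) ≤ 2)]
  have hsub : {ω | ∃ j < J, ∃ t ≤ T, Q t ω / 2 ^ (j + 1) + 2 ^ (j + 1) * b j < |S t ω|} ⊆
      ⋃ j ∈ Finset.range J, (A (1 / 2 ^ (j + 1)) j ∪ A (-(1 / 2 ^ (j + 1))) j) := by
    rintro ω ⟨j, hj, t, ht, hlt⟩
    simp only [Set.mem_iUnion, Finset.mem_range]
    refine ⟨j, hj, ?_⟩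
    have hp : (0 : ℝ) < 1 / 2 ^ (j + 1) := by positivity
    have h3 := mul_lt_mul_of_pos_left hlt hp
    have h4 : (1 : ℝ) / 2 ^ (j + 1) * (Q t ω / 2 ^ (j + 1) + 2 ^ (j + 1) * b j)
        = (1 / 2 ^ (j + 1)) ^ 2 * Q t ω + b j := by field_simp
    rw [h4] at h3
    rcases abs_cases (S t ω) with ⟨h5, _⟩ | ⟨h5, _⟩ <;> rw [h5] at h3
    · exact Or.inl ⟨t, ht, by linarith⟩
    · exact Or.inr ⟨t, ht, by rw [neg_sq]; linarith⟩
  calc _ ≤ P.real (⋃ j ∈ Finset.range J, (A (1 / 2 ^ (j + 1)) j ∪ A (-(1 / 2 ^ (j + 1))) j)) :=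
        measureReal_mono hsub (measure_ne_top _ _)
    _ ≤ ∑ j ∈ Finset.range J, P.real (A (1 / 2 ^ (j + 1)) j ∪ A (-(1 / 2 ^ (j + 1))) j) :=
        measureReal_biUnion_finset_le _ _
    _ ≤ ∑ j ∈ Finset.range J, δ * (1 / (((j : ℝ) + 1) * (j + 2))) := by
        refine Finset.sum_le_sum fun j _ => (measureReal_union_le _ _).trans ?_
        have h1 := h.exp_tail hx hw hint hb (hinv j) (b j) T
        have h2 := h.exp_tail hx hw hint hb ((abs_neg _).trans_le (hinv j)) (b j) T
        rw [hexp] at h1 h2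
        exact (add_le_add h1 h2).trans (le_of_eq (by ring))
    _ ≤ δ := by
        rw [← Finset.mul_sum]
        have h1 := sum_inv_mul_le J
        have h2 : (0 : ℝ) ≤ 1 / (J + 1) := by positivity
        nlinarith

/-- Almost sure bounds on the answers of the oracle transfer to the observed answers. -/
theorem IsOracleAnswer.ae_abs_inner_le (h : IsOracleAnswer P κ x g)
    (hx : ∀ t, Measurable[history g t] (x t)) (hw : ∀ t, Measurable[history g t] (w t))
    (hb : ∀ t ω, ∀ᵐ v ∂κ (x t ω), |inner ℝ v (w t ω)| ≤ 1) (t : ℕ) :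
    ∀ᵐ ω ∂P, |inner ℝ (g t ω) (w t ω)| ≤ 1 := by
  set B : Set ((Euc n × Euc n) × Euc n) := {p | |inner ℝ p.2 p.1.2| ≤ 1} with hB
  have hBm : MeasurableSet B := measurableSet_le (by fun_prop) measurable_const
  have hφ : Measurable (Bᶜ.indicator (1 : (Euc n × Euc n) × Euc n → ENNReal)) :=
    measurable_one.indicator hBm.compl
  have key := lintegral_eq_of_condLaw (history_le h.measurable t) (h.measurable t) (h.condLaw t)
    (Z := fun ω => (x t ω, w t ω)) ((hx t).prodMk (hw t)) (ψ := fun z => z.1) measurable_fst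
    (fun ω => rfl) hφ
  have h0 : ∀ ω, ∫⁻ v, Bᶜ.indicator (1 : (Euc n × Euc n) × Euc n → ENNReal) ((x t ω, w t ω), v)
      ∂κ (x t ω) = 0 := fun ω => by
    refine lintegral_eq_zero_of_ae_eq_zero ?_
    filter_upwards [hb t ω] with v hv
    have hmem : ((x t ω, w t ω), v) ∉ Bᶜ := fun hc => hc hv
    exact Set.indicator_of_notMem hmem _
  simp only [h0, lintegral_zero] at key
  have hpair : Measurable fun ω => ((x t ω, w t ω), g t ω) :=
    (((hx t).mono (history_le h.measurable t) le_rfl).prodMk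
      ((hw t).mono (history_le h.measurable t) le_rfl)).prodMk (h.measurable t)
  filter_upwards [(lintegral_eq_zero_iff (hφ.comp hpair)).1 key] with ω hω
  by_contra hc
  have : ((x t ω, w t ω), g t ω) ∈ Bᶜ := hc
  simp [Set.indicator_of_mem this] at hω

end Concentration

/-- Convexity bounds the gap of the weighted average by the weighted regret of the means. -/
theorem gap_mul_sum_le {n : ℕ} {X : Set (Euc n)} {f : Euc n → ℝ} {xstar : Euc n}
    (hf : ConvexProblem X f xstar) {rε : ℝ} (hr : 0 < rε) {x m : ℕ → Euc n} (hx : ∀ k, x k ∈ X)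
    (hm : ∀ k, m k ∈ subdifferential X f (x k)) (t : ℕ) :
    (f (xbar rε x (t + 1)) - f xstar) * ∑ k ∈ Finset.range (t + 1), rbar rε x k ≤
      ∑ k ∈ Finset.range (t + 1), rbar rε x k * inner ℝ (m k) (x k - xstar) := by
  have hpos : 0 < ∑ k ∈ Finset.range (t + 1), rbar rε x k :=
    Finset.sum_pos (fun k _ => rbar_pos hr x k) Finset.nonempty_range_add_one
  have h1 := hf.convexOn.map_centerMass_le (t := Finset.range (t + 1)) (w := rbar rε x) (p := x)
    (fun k _ => (rbar_pos hr x k).le) hpos fun k _ => hx k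
  have h2 : f (xbar rε x (t + 1)) * ∑ k ∈ Finset.range (t + 1), rbar rε x k ≤
      ∑ k ∈ Finset.range (t + 1), rbar rε x k * f (x k) := by
    have h3 := mul_le_mul_of_nonneg_right h1 hpos.le
    simp only [Finset.centerMass, smul_eq_mul, Function.comp] at h3
    rwa [mul_comm (_⁻¹) (Finset.sum _ _), inv_mul_cancel_right₀ hpos.ne'] at h3
  rw [sub_mul, Finset.mul_sum (a := f xstar)]
  refine (sub_le_sub_right h2 _).trans ?_
  rw [← Finset.sum_sub_distrib]
  refine Finset.sum_le_sum fun k _ => ?_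
  have h4 := hm k xstar hf.mem
  have h5 : f (x k) - f xstar ≤ inner ℝ (m k) (x k - xstar) := by
    rw [← neg_sub xstar (x k), inner_neg_right]; linarith
  have h6 := mul_le_mul_of_nonneg_left h5 (rbar_pos hr x k).le
  linarith

/-- The part of the argument on a sample path: a deterministic control of the noise, in terms of
normalised directions `w`, gives the bound on the gap. -/
theorem gap_le {n : ℕ} {X : Set (Euc n)} {f : Euc n → ℝ} {xstar : Euc n}
    (hf : ConvexProblem X f xstar) {rε : ℝ} (hr : 0 < rε) {x g m w : ℕ → Euc n} {G' : ℕ → ℝ}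
    (hx : ∀ k, x k ∈ X) (hm : ∀ k, m k ∈ subdifferential X f (x k))
    (hstep : ∀ t, IsProjection X (x t - (rbar rε x t / √(G' t)) • g t) (x (t + 1)))
    (hpos : ∀ t, 0 < G' t) (hmono : Monotone G') (hle : ∀ t, gradSum g t ≤ G' t)
    {L θ : ℝ} (hL : 0 < L) (hθ : 0 ≤ θ) {t : ℕ}
    (hw : ∀ k ≤ t, w k = (L * (‖x 0 - xstar‖ + rbar rε x k))⁻¹ • (x k - xstar))
    (hS : ∀ s ≤ t + 1, |∑ k ∈ Finset.range s, inner ℝ (g k - m k) (w k)| ≤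
      8 * √((∑ k ∈ Finset.range (t + 1), inner ℝ (g k) (w k) ^ 2) * θ + θ ^ 2)) :
    f (xbar rε x (t + 1)) - f xstar ≤ 19 * ((‖x 0 - xstar‖ + rbar rε x (t + 1)) *
      √(G' t + gradSum g t * θ + L ^ 2 * θ ^ 2) /
        ∑ i ∈ Finset.range (t + 1), rbar rε x i / rbar rε x (t + 1)) := by
  set R := rbar rε x (t + 1) with hRdef
  set d := ‖x 0 - xstar‖ with hd
  have hd0 : 0 ≤ d := norm_nonneg _
  have hR : 0 < R := rbar_pos hr x _
  have hrp : ∀ k, 0 < rbar rε x k := rbar_pos hr x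
  have hDp : ∀ k, 0 < d + rbar rε x k := fun k => add_pos_of_nonneg_of_pos hd0 (hrp k)
  have hG0 : 0 ≤ gradSum g t := Finset.sum_nonneg fun _ _ => by positivity
  set W := √(G' t + gradSum g t * θ + L ^ 2 * θ ^ 2) with hW
  set Q := ∑ k ∈ Finset.range (t + 1), inner ℝ (g k) (w k) ^ 2 with hQ
  have hgap := gap_mul_sum_le hf hr hx hm t
  have hreg := weighted_regret_le hf.convexOn.1 hr hf.mem hstep hpos hmono hle t
  have hnoise : ∑ k ∈ Finset.range (t + 1), rbar rε x k * inner ℝ (m k - g k) (x k - xstar) ≤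
      16 * (R * (d + R)) * (L * √(Q * θ + θ ^ 2)) := by
    set S : ℕ → ℝ := fun s => ∑ k ∈ Finset.range s, inner ℝ (g k - m k) (w k) with hSdef
    have hamono : Monotone fun k => rbar rε x k * (d + rbar rε x k) := fun i j hij =>
      mul_le_mul (rbar_mono rε x hij) (add_le_add le_rfl (rbar_mono rε x hij)) (hDp i).le (hrp j).le
    have h1 := sum_mul_sub_le (u := S) (D := 8 * √(Q * θ + θ ^ 2)) (t := t) hamono
      (mul_pos (hrp 0) (hDp 0)).le fun k hk => (le_abs_self _).trans (hS k hk)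
    have h2 : ∑ k ∈ Finset.range (t + 1), rbar rε x k * inner ℝ (m k - g k) (x k - xstar)
        = L * ∑ k ∈ Finset.range (t + 1),
          rbar rε x k * (d + rbar rε x k) * (S k - S (k + 1)) := by
      rw [Finset.mul_sum]
      refine Finset.sum_congr rfl fun k hk => ?_
      have h3 : S (k + 1) = S k + inner ℝ (g k - m k) (w k) := Finset.sum_range_succ _ _
      have h4 := (hDp k).ne'
      rw [h3, hw k (by simp at hk; omega), inner_smul_right, ← neg_sub (g k), inner_neg_left]
      field_simp
      ring
    -- Both `D` and `-S (t + 1)` are at most `8 √(Q θ + θ²)`, whence the `16`; with the `3` of the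
    -- regret bound this gives the constant `19`.
    have h5 := neg_le_of_abs_le (hS (t + 1) le_rfl)
    have h6 : rbar rε x t * (d + rbar rε x t) ≤ R * (d + R) := hamono t.le_succ
    have h7 : rbar rε x t * (d + rbar rε x t) * (8 * √(Q * θ + θ ^ 2) - S (t + 1)) ≤
        R * (d + R) * (16 * √(Q * θ + θ ^ 2)) :=
      mul_le_mul h6 (by simp only [hSdef]; linarith)
        (by linarith [le_of_abs_le (hS (t + 1) le_rfl)]) (by positivity)
    rw [h2]
    have h8 := mul_le_mul_of_nonneg_left (h1.trans h7) hL.le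
    linarith
  have hQG : L ^ 2 * Q ≤ gradSum g t := by
    rw [hQ, gradSum, Finset.mul_sum]
    refine Finset.sum_le_sum fun k hk => ?_
    have hk' : k ≤ t := by simp at hk; omega
    have h1 : L * ‖w k‖ ≤ 1 := by
      rw [hw k hk', norm_smul, norm_inv, Real.norm_of_nonneg (mul_pos hL (hDp k)).le]
      have h2 : ‖x k - xstar‖ ≤ d + rbar rε x k := norm_sub_le_add_rbar rε x xstar le_rfl
      have h4 := hDp k
      rw [mul_inv, mul_assoc, mul_inv_cancel_left₀ hL.ne', inv_mul_le_iff₀ h4, mul_one]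
      exact h2
    have h3 : |L * inner ℝ (g k) (w k)| ≤ ‖g k‖ := by
      rw [abs_mul, abs_of_pos hL]
      have := mul_le_mul_of_nonneg_left (abs_real_inner_le_norm (g k) (w k)) hL.le
      nlinarith [norm_nonneg (g k)]
    rw [← mul_pow, ← sq_abs]
    gcongr
  have hQW : L * √(Q * θ + θ ^ 2) ≤ W := by
    rw [← Real.sqrt_sq hL.le, ← Real.sqrt_mul (sq_nonneg L)]
    refine Real.sqrt_le_sqrt ?_
    nlinarith [mul_le_mul_of_nonneg_right hQG hθ, hpos t]
  have hGW : √(G' t) ≤ W := Real.sqrt_le_sqrt (by nlinarith [mul_nonneg hG0 hθ, sq_nonneg (L * θ)])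
  have hsum : 0 < ∑ k ∈ Finset.range (t + 1), rbar rε x k :=
    Finset.sum_pos (fun k _ => hrp k) Finset.nonempty_range_add_one
  have hsplit : ∑ k ∈ Finset.range (t + 1), rbar rε x k * inner ℝ (m k) (x k - xstar)
      = (∑ k ∈ Finset.range (t + 1), rbar rε x k * inner ℝ (g k) (x k - xstar))
        + ∑ k ∈ Finset.range (t + 1), rbar rε x k * inner ℝ (m k - g k) (x k - xstar) := by
    rw [← Finset.sum_add_distrib]
    refine Finset.sum_congr rfl fun k _ => ?_
    rw [inner_sub_left]; ring
  rw [← Finset.sum_div, div_div_eq_mul_div, ← mul_div_assoc, le_div_iff₀ hsum]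
  have hc : 0 ≤ R * (d + R) := by positivity
  have e1 := mul_le_mul_of_nonneg_left hQW (show 0 ≤ 16 * (R * (d + R)) by positivity)
  have e2 := mul_le_mul_of_nonneg_left hGW (show 0 ≤ 3 * (R * (d + R)) by positivity)
  linarith

/-! ### Measurability of the iterates and of the noise directions -/

/-- The iterates of DoG-like projected SGD are determined by the past answers. -/
theorem measurable_iterate {Ω : Type*} [MeasurableSpace Ω] {P : Measure Ω} {n : ℕ}
    {X : Set (Euc n)} (hX : Convex ℝ X) (hc : IsClosed X) {x₀ : Euc n} (h₀ : x₀ ∈ X) {rε : ℝ}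
    {x g : ℕ → Ω → Euc n} {G' η : ℕ → Ω → ℝ} (hs : IsProjectedSGD X x₀ η x g)
    (hd : IsDoGLike P rε x g G' η) (t : ℕ) : Measurable[history g t] (x t) := by
  obtain ⟨proj, hpm, hp⟩ := exists_measurable_projection hX hc ⟨x₀, h₀⟩
  induction t using Nat.strong_induction_on with
  | _ t ih =>
    cases t with
    | zero =>
      rw [show x 0 = fun _ => x₀ from funext hs.init]
      exact measurable_const
    | succ t =>
      have hx : ∀ k ≤ t, Measurable[history g (t + 1)] (x k) := fun k hk =>
        (ih k (by omega)).mono (history_mono g (by omega)) le_rfl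
      have hr := @measurable_rbar Ω (history g (t + 1)) n rε x t hx
      have hη : Measurable[history g (t + 1)] (η t) := by
        rw [show η t = _ from funext (hd.step_eq t)]
        exact hr.div (Real.continuous_sqrt.measurable.comp (hd.adapted t))
      rw [show x (t + 1) = fun ω => proj (x t ω - η t ω • g t ω) from
        funext fun ω => hp _ _ (hs.step t ω)]
      exact hpm.comp ((hx t le_rfl).sub (hη.smul (measurable_history g t.lt_succ_self)))

/-- The σ-algebra is arbitrary so that it can be taken to be `history g t`, which makes the
directions predictable. -/
theorem measurable_direction {Ω : Type*} [MeasurableSpace Ω] {n : ℕ} (rε L : ℝ) (z : Euc n)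
    {K : Set (Euc n)} (hK : MeasurableSet K) {x : ℕ → Ω → Euc n} {t : ℕ}
    (hx : ∀ k ≤ t, Measurable (x k)) :
    Measurable fun ω => (K.indicator (fun _ => (1 : ℝ)) (x t ω) *
      (L * (‖x 0 ω - z‖ + rbar rε (fun k => x k ω) t))⁻¹) • (x t ω - z) :=
  Measurable.smul (((measurable_const.indicator hK).comp (hx t le_rfl)).mul
    ((((hx 0 t.zero_le).sub_const z).norm.add (measurable_rbar rε hx)).const_mul L).inv)
    ((hx t le_rfl).sub_const z)

end DoG
-- Assembly: truncation, exceptional events and the final bound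
theorem mainTheorem3 :
    ∃ C : ℝ, 0 < C ∧
      ∀ (n : ℕ) (X : Set (DoG.Euc n)) (f : DoG.Euc n → ℝ) (xstar x₀ : DoG.Euc n)
        (κ : Kernel (DoG.Euc n) (DoG.Euc n)) [IsMarkovKernel κ] (ℓ : DoG.Euc n → ℝ) (rε : ℝ)
        (Ω : Type*) [MeasurableSpace Ω] (P : Measure Ω) [IsProbabilityMeasure P]
        (x g : ℕ → Ω → DoG.Euc n) (G' η : ℕ → Ω → ℝ),
        DoG.ConvexProblem X f xstar →
        DoG.IsStochasticGradientOracle X f κ →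
        DoG.PointwiseBounded X κ ℓ →
        x₀ ∈ X → 0 < rε →
        DoG.IsOracleAnswer P κ x g →
        DoG.IsProjectedSGD X x₀ η x g →
        DoG.IsDoGLike P rε x g G' η →
        ∀ (δ L : ℝ) (T : ℕ), 0 < δ → δ < 1 → 0 < L →
          1 - δ - P.real {ω | L < DoG.Lbar ℓ (fun k => x k ω) T} ≤
            P.real {ω | ∀ t : ℕ, 1 ≤ t → t ≤ T →
              f (DoG.xbar rε (fun k => x k ω) t) - f xstar ≤
                C * ((‖x₀ - xstar‖ + DoG.rbar rε (fun k => x k ω) t) *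
                  √(G' (t - 1) ω + DoG.gradSum (fun k => g k ω) (t - 1) * DoG.theta t δ
                    + L ^ 2 * DoG.theta t δ ^ 2) /
                  ∑ i ∈ Finset.range t,
                    DoG.rbar rε (fun k => x k ω) i / DoG.rbar rε (fun k => x k ω) t)} := by
  refine ⟨19, by norm_num, ?_⟩
  intro n X f xstar x₀ κ _ ℓ rε Ω _ P _ x g G' η hf hκ hℓ h₀ hr hora hsgd hdog δ L T hδ0 hδ1 hL
  have hmem : ∀ t ω, x t ω ∈ X := fun t ω => by
    cases t with
    | zero => rw [hsgd.init]; exact h₀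
    | succ t => exact (hsgd.step t ω).1
  have hxm := DoG.measurable_iterate hf.convexOn.1 hf.isClosed h₀ hsgd hdog
  have hint : ∀ t ω, Integrable (fun v : DoG.Euc n => v) (κ (x t ω)) := fun t ω =>
    (hκ _ (hmem t ω)).1
  set K : Set (DoG.Euc n) := X ∩ ℓ ⁻¹' Set.Iic L with hK
  have hKm : MeasurableSet K :=
    (hℓ.continuousOn.preimage_isClosed_of_isClosed hf.isClosed isClosed_Iic).measurableSet
  set D : ℕ → Ω → ℝ := fun t ω => ‖x 0 ω - xstar‖ + DoG.rbar rε (fun k => x k ω) t with hD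
  have hDpos : ∀ t ω, 0 < D t ω := fun t ω =>
    add_pos_of_nonneg_of_pos (norm_nonneg _) (DoG.rbar_pos hr _ _)
  -- The indicator kills the direction wherever `ℓ` exceeds `L`, so the noise is bounded by `1`
  -- unconditionally; up to time `T` it equals `1` when `L̄_T ≤ L`, at the price of the event `big`.
  set w : ℕ → Ω → DoG.Euc n := fun t ω =>
    (K.indicator (fun _ => (1 : ℝ)) (x t ω) * (L * D t ω)⁻¹) • (x t ω - xstar) with hw
  have hwm : ∀ t, Measurable[DoG.history g t] (w t) := fun t => by
    have h1 : ∀ k ≤ t, Measurable[DoG.history g t] (x k) := fun k hk =>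
      (hxm k).mono (DoG.history_mono g hk) le_rfl
    exact @DoG.measurable_direction Ω (DoG.history g t) n rε L xstar K hKm x t h1
  have hb : ∀ t ω, ∀ᵐ v ∂κ (x t ω), |inner ℝ v (w t ω)| ≤ 1 := fun t ω => by
    by_cases hKx : x t ω ∈ K
    · filter_upwards [hℓ.bound _ (hmem t ω)] with v hv
      have h1 : ‖x t ω - xstar‖ ≤ D t ω :=
        DoG.norm_sub_le_add_rbar rε (fun k => x k ω) xstar le_rfl
      have h2 : ‖v‖ ≤ L := hv.trans hKx.2
      have h3 : 0 < L * D t ω := mul_pos hL (hDpos t ω)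
      simp only [hw, Set.indicator_of_mem hKx, one_mul, inner_smul_right, abs_mul, abs_inv,
        abs_of_pos hL, abs_of_pos (hDpos t ω)]
      rw [inv_mul_le_iff₀ h3, mul_one]
      exact (abs_real_inner_le_norm _ _).trans (mul_le_mul h2 h1 (norm_nonneg _) hL.le)
    · simp [hw, Set.indicator_of_notMem hKx]
  set bad := {ω | ∃ j < 2 * T, ∃ t ≤ T,
      (∑ k ∈ Finset.range t, inner ℝ (g k ω) (w k ω) ^ 2) / 2 ^ (j + 1) +
        2 ^ (j + 1) * Real.log (2 * (j + 1) * (j + 2) / δ) <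
      |∑ k ∈ Finset.range t, inner ℝ (g k ω - DoG.mean κ (x k ω)) (w k ω)|} with hbad
  have hbadP : P.real bad ≤ δ := hora.dyadic_tail hxm hwm hint hb hδ0 (2 * T) T
  -- This gives `Q ≤ t` along the path, which is why the scales `j < 2 * T` suffice.
  have hae : ∀ᵐ ω ∂P, ∀ t, |inner ℝ (g t ω) (w t ω)| ≤ 1 :=
    ae_all_iff.2 fun t => hora.ae_abs_inner_le hxm hwm hb t
  set big := {ω | L < DoG.Lbar ℓ (fun k => x k ω) T} with hbig
  set good := {ω | ∀ t : ℕ, 1 ≤ t → t ≤ T →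
    f (DoG.xbar rε (fun k => x k ω) t) - f xstar ≤
      19 * ((‖x₀ - xstar‖ + DoG.rbar rε (fun k => x k ω) t) *
        √(G' (t - 1) ω + DoG.gradSum (fun k => g k ω) (t - 1) * DoG.theta t δ
          + L ^ 2 * DoG.theta t δ ^ 2) /
        ∑ i ∈ Finset.range t,
          DoG.rbar rε (fun k => x k ω) i / DoG.rbar rε (fun k => x k ω) t)} with hgood
  have hcover : ∀ᵐ ω ∂P, ω ∈ good ∪ (bad ∪ big) := by
    filter_upwards [hae, hdog.pos, hdog.monotone, hdog.gradSum_le] with ω hω hpos hmono hle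
    by_contra hnot
    simp only [Set.mem_union, not_or] at hnot
    obtain ⟨hng, hnb, hnL⟩ := hnot
    refine hng fun t ht1 htT => ?_
    obtain ⟨t, rfl⟩ : ∃ s, t = s + 1 := ⟨t - 1, by omega⟩
    have hK' : ∀ k ≤ t, x k ω ∈ K := fun k hk => ⟨hmem k ω,
      (DoG.le_runningMax (fun k => ℓ (x k ω)) (show k ≤ T by omega)).trans (not_lt.1 hnL)⟩
    have hQ0 : ∀ s, 0 ≤ ∑ k ∈ Finset.range s, (inner ℝ (g k ω) (w k ω) : ℝ) ^ 2 := fun s =>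
      Finset.sum_nonneg fun _ _ => sq_nonneg _
    have hQt : ∑ k ∈ Finset.range (t + 1), (inner ℝ (g k ω) (w k ω) : ℝ) ^ 2 ≤
        ((t + 1 : ℕ) : ℝ) := by
      refine (Finset.sum_le_card_nsmul _ _ 1 fun k _ => ?_).trans (by simp)
      rw [← sq_abs]
      exact pow_le_one₀ (abs_nonneg _) (hω k)
    obtain ⟨j, hj, hscale⟩ := DoG.exists_scale ht1 hδ0 hδ1 (hQ0 (t + 1)) hQt
    have hfin := DoG.gap_le hf hr (x := fun k => x k ω) (g := fun k => g k ω)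
      (m := fun k => DoG.mean κ (x k ω)) (w := fun k => w k ω) (G' := fun k => G' k ω)
      (fun k => hmem k ω) (fun k => (hκ _ (hmem k ω)).2)
      (fun t => hdog.step_eq t ω ▸ hsgd.step t ω) hpos hmono hle hL
      (zero_le_one.trans (DoG.one_le_theta ht1 hδ0 hδ1)) (t := t)
      (fun k hk => by simp only [hw, Set.indicator_of_mem (hK' k hk), one_mul, hD])
      -- The scale is chosen for the final `Q` but serves every `s ≤ t + 1`, since `Q` is
      -- nondecreasing in time.
      (fun s hs => by
        by_contra! hlt
        refine hnb ⟨j, by omega, s, by omega, lt_of_le_of_lt (le_trans ?_ hscale) hlt⟩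
        refine add_le_add (div_le_div_of_nonneg_right ?_ (by positivity)) le_rfl
        exact Finset.sum_le_sum_of_subset_of_nonneg (Finset.range_subset_range.2 hs)
          fun _ _ _ => sq_nonneg _)
    simpa only [hsgd.init, Nat.add_sub_cancel] using hfin
  -- Only subadditivity is used from here, so `good` need not be measurable.
  have hone : P.real (good ∪ (bad ∪ big)) = 1 := by
    have h : (good ∪ (bad ∪ big) : Set Ω) =ᵐ[P] Set.univ := Filter.eventuallyEq_univ.2 hcover
    rw [measureReal_congr h, probReal_univ]
  have h1 := measureReal_union_le (μ := P) good (bad ∪ big)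
  have h2 := measureReal_union_le (μ := P) bad big
  linarith
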